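/- Let $G$ be a finite group and $p$ a prime. Let $R$ be the ring of all algebraic integers in $\mathbb{C}$, $K\subset\mathbb{C}$ its field of fractions (the field of algebraic numbers), $I$ a maximal ideal of $R$ containing $p$, and $F=R/I$. Let $\mathcal{C}(G)$ be the $K$-space of $K$-valued class functions on $G$, with inner product $\langle\lambda,\mu\rangle=\frac{1}{|G|}\sum_{g\in G}\lambda(g)\overline{\mu(g)}$, let $\mathbf{1}_G$ be the trivial character, and for $\psi\in\mathcal{C}(G)$ let $\hat\psi$ be the class function that agrees with $\psi$ on the $p$-regular elements (those of order prime to $p$) and vanishes on the other elements; $d:\psi\mapsto\hat\psi$ is the decomposition map. Let $\mathrm{Irr}(G)$ be the set of irreducible $K$-characters of $G$, and $\mathrm{IBr}(G)$ the set of Brauer characters of irreducible $F$-representations of $G$. Here the Brauer character of an $F$-representation $\mathcal{X}$ takes at a $p$-regular element $g$ the value $\sum_i\tilde\zeta_i$, where the $\zeta_i$ are the eigenvalues of $\mathcal{X}(g)$ with multiplicity and $\tilde\zeta_i\in R$ is the unique $|G|_{p'}$-th root of unity with $\tilde\zeta_i+I=\zeta_i$; it is extended by $0$ to all of $G$. The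 decomposition numbers $d_{\chi\varphi}\in\mathbb{Z}_{\ge 0}$ are defined by $\hat\chi=\sum_{\varphi\in\mathrm{IBr}(G)}d_{\chi\varphi}\varphi$ for $\chi\in\mathrm{Irr}(G)$. The blocks of $G$ are the connected components of the graph on $\mathrm{Irr}(G)$ in which $\chi\ne\psi$ are adjacent when $d_{\chi\varphi}\ne 0\ne d_{\psi\varphi}$ for some $\varphi\in\mathrm{IBr}(G)$. Let $B$ be a union of blocks of $G$, let $\mathrm{Irr}(B)$ be the set of $\chi\in\mathrm{Irr}(G)$ that lie in $B$, and $\mathrm{IBr}(B)$ the set of $\varphi\in\mathrm{IBr}(G)$ with $d_{\chi\varphi}\neq 0$ for some $\chi\in\mathrm{Irr}(B)$; both sets are finite. Let $\alpha:\mathcal{C}(G)\to\mathcal{C}(G)$, $\vartheta\mapsto{}^\alpha\vartheta$, be a $K$-linear map that commutes with $d$ and maps $\mathrm{Irr}(B)$ into $\mathrm{Irr}(B)$ and $\mathrm{IBr}(B)$ into $\mathrm{IBr}(B)$. Let $\rho$ be the class function $$\rho(g)=\sum_{\chi\in\mathrm{Irr}(B)}\chi(g)\,{}^\alpha\chi(g^{-1}),\qquad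 g\in G.$$ Then the numbers of $\alpha$-invariant elements are $$|\{\chi\in\mathrm{Irr}(B):{}^\alpha\chi=\chi\}|=\langle\mathbf{1}_G,\rho\rangle\quad\text{and}\quad|\{\varphi\in\mathrm{IBr}(B):{}^\alpha\varphi=\varphi\}|=\langle\mathbf{1}_G,\hat\rho\rangle.$$ -/

import Mathlib

noncomputable section

namespace BrauerBlocks

universe u

/-- The field `K` of algebraic numbers, i.e. the field of fractions of the ring of all algebraic
integers, as a subfield of `ℂ`. -/
abbrev AlgNum : Type := algebraicClosure ℚ ℂ

/-- The ring `R` of all algebraic integers. -/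
abbrev AlgInt : Type := integralClosure ℤ AlgNum

/-- For a maximal ideal `I` of `R`, the ring `F = R ⧸ I` is a field. -/
instance residueField (I : Ideal AlgInt) [I.IsMaximal] : Field (AlgInt ⧸ I) :=
  Ideal.Quotient.field I

/-- `𝒞(G)`: the `K`-valued class functions on `G`. -/
def ClassFun (G : Type u) [Group G] : Submodule AlgNum (G → AlgNum) where
  carrier := {f | ∀ g h : G, f (h * g * h⁻¹) = f g}
  add_mem' := fun {a b} ha hb g h => by
    rw [Pi.add_apply, Pi.add_apply, ha g h, hb g h]
  zero_mem' := fun _ _ => rfl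
  smul_mem' := fun c a ha g h => by
    rw [Pi.smul_apply, Pi.smul_apply, ha g h]

/-- The trivial character `1_G`. -/
def trivialChar (G : Type u) [Group G] : ClassFun G :=
  ⟨fun _ => 1, fun _ _ => rfl⟩

/-- The usual inner product `⟨f₁, f₂⟩ = |G|⁻¹ ∑ g, f₁ g * conj (f₂ g)` of class functions. -/
def inner {G : Type u} [Group G] [Fintype G] (f₁ f₂ : ClassFun G) : ℂ :=
  (Fintype.card G : ℂ)⁻¹ * ∑ g : G, (f₁.1 g : ℂ) * starRingEnd ℂ (f₂.1 g : ℂ)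

/-- `g` is `p`-regular: its order is not divisible by `p`. -/
def IsPRegular {G : Type u} [Group G] (p : ℕ) (g : G) : Prop := ¬ p ∣ orderOf g

theorem isPRegular_conj {G : Type u} [Group G] (p : ℕ) (g h : G) :
    IsPRegular p (h * g * h⁻¹) ↔ IsPRegular p g := by
  unfold IsPRegular
  rw [← MulAut.conj_apply, MulEquiv.orderOf_eq]

open Classical in
/-- The decomposition map `f ↦ f̂` on class functions: `f̂` agrees with `f` on the `p`-regular
elements and vanishes on the `p`-singular ones. -/
def decompMap {G : Type u} [Group G] (p : ℕ) : ClassFun G →ₗ[AlgNum] ClassFun G where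
  toFun f := ⟨fun g => if IsPRegular p g then f.1 g else 0, fun g h => by
    simp only [isPRegular_conj, f.2 g h]⟩
  map_add' a b := by
    ext1; funext g
    change (if _ then a.1 g + b.1 g else 0) = (if _ then a.1 g else 0) + (if _ then b.1 g else 0)
    split_ifs <;> simp
  map_smul' c a := by
    ext1; funext g
    change (if _ then c * a.1 g else 0) = c * (if _ then a.1 g else 0)
    split_ifs <;> simp

/-- The class function afforded by a representation over `K`. -/
def ordinaryChar {G : Type u} [Group G] {n : ℕ}
    (X : Representation AlgNum G (Fin n → AlgNum)) : ClassFun G :=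
  ⟨X.character, fun g h => X.char_conj g h⟩

/-- `Irr(G)`: the irreducible `K`-characters of `G`. -/
def Irr (G : Type u) [Group G] : Set (ClassFun G) :=
  {χ | ∃ (n : ℕ) (X : Representation AlgNum G (Fin n → AlgNum)),
    X.IsIrreducible ∧ χ = ordinaryChar X}

/-- The inverse of the bijection, given by reduction modulo `I`, from the `m`-th roots of unity
in `R` to those in `F = R ⧸ I` (to be used with `m` prime to the characteristic of `F`). -/
def rootLift (I : Ideal AlgInt) (m : ℕ) (x : AlgInt ⧸ I) : AlgInt :=
  Function.invFunOn (Ideal.Quotient.mk I) {ζ : AlgInt | ζ ^ m = 1} x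

theorem charpoly_conj {F : Type*} [Field F] {G : Type u} [Group G] {n : ℕ}
    (X : Representation F G (Fin n → F)) (g h : G) :
    (X (h * g * h⁻¹)).charpoly = (X g).charpoly := by
  have e : X (h * g * h⁻¹) = (LinearEquiv.ofLinearMap (X h) (X h⁻¹)
      (by rw [← Module.End.mul_eq_comp, ← map_mul]; simp [Module.End.one_eq_id])
      (by rw [← Module.End.mul_eq_comp, ← map_mul]; simp [Module.End.one_eq_id])).conj (X g) := by
    ext1
    simp [LinearEquiv.conj_apply, map_mul, Module.End.mul_eq_comp, LinearMap.comp_assoc]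
  rw [e, LinearEquiv.charpoly_conj]

open Classical in
/-- The Brauer character afforded by a representation `X` over `F = R ⧸ I`. At a `p`-regular `g`
it is the sum, over the eigenvalues of `X g` counted with multiplicity, of the corresponding
`|G|_{p'}`-th roots of unity of `R`; it is extended by `0` to the `p`-singular elements. -/
def brauerChar {G : Type u} [Group G] (p : ℕ) (I : Ideal AlgInt) [I.IsMaximal] {n : ℕ}
    (X : Representation (AlgInt ⧸ I) G (Fin n → AlgInt ⧸ I)) : ClassFun G :=
  ⟨fun g => if IsPRegular p g then
      ((X g).charpoly.roots.map
        fun x => (rootLift I (ordCompl[p] (Nat.card G)) x : AlgNum)).sum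
    else 0,
   fun g h => by simp only [isPRegular_conj, charpoly_conj]⟩

/-- `IBr(G)`: the irreducible Brauer characters of `G` (with respect to `I`). -/
def IBr (G : Type u) [Group G] (p : ℕ) (I : Ideal AlgInt) [I.IsMaximal] : Set (ClassFun G) :=
  {φ | ∃ (n : ℕ) (X : Representation (AlgInt ⧸ I) G (Fin n → AlgInt ⧸ I)),
    X.IsIrreducible ∧ φ = brauerChar p I X}

open Classical in
/-- The decomposition numbers `d_{χφ}` of `χ`, as a function of `φ ∈ IBr(G)`: the non-negative
integers with `χ̂ = ∑ φ, d_{χφ} φ`. -/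
def decompNumber {G : Type u} [Group G] (p : ℕ) (I : Ideal AlgInt) [I.IsMaximal]
    (χ : Irr G) : IBr G p I →₀ ℕ :=
  if h : ∃ d : IBr G p I →₀ ℕ, decompMap p χ.1 = d.sum fun φ k => k • φ.1
  then h.choose else 0

/-- The Brauer graph: distinct `χ, ψ ∈ Irr(G)` are linked if `d_{χφ} ≠ 0 ≠ d_{ψφ}` for some
`φ ∈ IBr(G)`. Its connected components are the blocks of `G`. -/
def brauerGraph (G : Type u) [Group G] (p : ℕ) (I : Ideal AlgInt) [I.IsMaximal] :
    SimpleGraph (Irr G) :=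
  SimpleGraph.fromRel fun χ ψ =>
    ∃ φ : IBr G p I, decompNumber p I χ φ ≠ 0 ∧ decompNumber p I ψ φ ≠ 0

/-- The blocks of `G`. A union of blocks is encoded as the set of the blocks in it. -/
abbrev Block (G : Type u) [Group G] (p : ℕ) (I : Ideal AlgInt) [I.IsMaximal] : Type u :=
  (brauerGraph G p I).ConnectedComponent

section UnionOfBlocks

variable {G : Type u} [Group G] {p : ℕ} {I : Ideal AlgInt} [I.IsMaximal]

/-- `Irr(B)`: the irreducible `K`-characters belonging to the union of blocks `B`. -/
def IrrOf (B : Set (Block G p I)) : Set (ClassFun G) :=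
  {χ | ∃ h : χ ∈ Irr G, (brauerGraph G p I).connectedComponentMk ⟨χ, h⟩ ∈ B}

/-- `IBr(B)`: the irreducible Brauer characters belonging to the union of blocks `B`, i.e. those
that occur in `χ̂` for some `χ ∈ Irr(B)`. -/
def IBrOf (B : Set (Block G p I)) : Set (ClassFun G) :=
  {φ | ∃ h : φ ∈ IBr G p I, ∃ χ : Irr G,
    χ.1 ∈ IrrOf B ∧ decompNumber p I χ ⟨φ, h⟩ ≠ 0}

/-- The class function `ρ(g) = ∑_{χ ∈ Irr(B)} χ(g) (αχ)(g⁻¹)`. -/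
def twistedSum (B : Set (Block G p I)) (α : ClassFun G →ₗ[AlgNum] ClassFun G) : ClassFun G :=
  ⟨fun g => ∑ᶠ χ ∈ IrrOf B, χ.1 g * (α χ).1 g⁻¹, fun g h => by
    have e : (h * g * h⁻¹)⁻¹ = h * g⁻¹ * h⁻¹ := by group
    simp only [e]
    refine finsum_congr fun χ => finsum_congr fun _ => ?_
    rw [χ.2 g h, (α χ).2 g⁻¹ h]⟩

end UnionOfBlocks

end BrauerBlocks

end

/-! Write [f, h] for the bilinear form `pairing`. Irreducible ordinary characters are orthonormal,
so the sum of [χ, αχ] over Irr(B), which is ⟨1, ρ⟩, counts the α-fixed χ.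

For ρ̂ the summand is [dχ, αχ]. The map d is self-adjoint and commutes with α, so this equals [χ,
α(dχ)] = ∑_φ d_{χφ} [χ, αφ]. Only φ in IBr(B) occur, and for such φ every χ with d_{χφ} ≠ 0 lies in
B. The sum over χ may therefore run over all of Irr(G), which gives [Φ_φ, αφ] with Φ_φ = ∑_χ d_{χφ}
χ. By the duality `sum_decompNumber_mul_pairing` this is 1 if αφ = φ and 0 otherwise.

The duality comes from expanding a Brauer character in Irr(G), applying d and comparing
coefficients. It rests on three facts: Irr(G) spans the class functions (`eq_sum_pairing_irr`),
decomposition numbers exist (`exists_decompMap_eq_sum`, by reducing a form over a valuation ring),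
and IBr(G) is linearly independent (`linearIndependent_ibr`, by lifting the independence of
irreducible characters over F). -/

open scoped MonoidAlgebra Polynomial

namespace BrauerBlocks

/-! ### Schur's lemma and density -/

section SimpleModules

variable {k A ι : Type*} [Field k] [IsAlgClosed k] [Ring A] [Algebra k A] {V : ι → Type*}
  [∀ i, AddCommGroup (V i)] [∀ i, Module k (V i)] [∀ i, Module A (V i)]
  [∀ i, IsScalarTower k A (V i)] [∀ i, FiniteDimensional k (V i)] [∀ i, IsSimpleModule A (V i)]

/-- Elements of an algebra over an algebraically closed field act independently on finitely many
pairwise non-isomorphic simple modules. -/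
theorem exists_smul_eq_of_pairwise_not_equiv [Finite ι]
    (hV : Pairwise fun i j => IsEmpty (V i ≃ₗ[A] V j)) (T : ∀ i, V i →ₗ[k] V i) :
    ∃ a : A, ∀ i, ∀ v : V i, a • v = T i v := by
  classical
  have := Fintype.ofFinite ι
  have hcomp : ∀ (φ : Module.End A (∀ i, V i)) (i j : ι), ∃ c : k, (i ≠ j → c = 0) ∧
      ∀ v : V j, φ (Pi.single j v) i = if h : i = j then c • (h ▸ v) else 0 := by
    intro φ i j
    let ψ : V j →ₗ[A] V i := LinearMap.proj i ∘ₗ φ ∘ₗ LinearMap.single A V j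
    by_cases h : i = j
    · subst h
      obtain ⟨c, hc⟩ :=
        (IsSimpleModule.algebraMap_end_bijective_of_isAlgClosed (A := A) (V := V i) k).2 ψ
      refine ⟨c, fun h => (h rfl).elim, fun v => ?_⟩
      have := LinearMap.congr_fun hc v
      simpa [ψ, Module.algebraMap_end_apply] using this.symm
    · refine ⟨0, fun _ => rfl, fun v => ?_⟩
      rcases LinearMap.bijective_or_eq_zero ψ with hb | h0
      · exact ((hV (Ne.symm h)).false (LinearEquiv.ofBijective ψ hb)).elim
      · have := LinearMap.congr_fun h0 v
        simpa [ψ, h] using this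
  have hact : ∀ φ : Module.End A (∀ i, V i), ∃ c : ι → k, ∀ (x : ∀ i, V i) i,
      φ x i = c i • x i := by
    intro φ
    choose c _ hc using fun i => hcomp φ i i
    refine ⟨c, fun x i => ?_⟩
    conv_lhs => rw [← Finset.univ_sum_single x]
    rw [map_sum, Finset.sum_apply, Finset.sum_eq_single i]
    · simp [hc]
    · intro j _ hj
      obtain ⟨d, _, hd⟩ := hcomp φ i j
      rw [hd, dif_neg hj.symm]
    · simp
  -- By Schur every `A`-endomorphism of the product acts by a scalar on each factor, so the family
  -- `T` commutes with all of them and the density theorem applies.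
  let f : Module.End (Module.End A (∀ i, V i)) (∀ i, V i) :=
    { toFun := fun x i => T i (x i)
      map_add' := fun x y => by ext i; simp
      map_smul' := fun φ x => by
        obtain ⟨c, hc⟩ := hact φ
        ext i
        simp [Module.End.smul_def, hc] }
  let b := fun i => Module.finBasis k (V i)
  obtain ⟨a, ha⟩ := jacobson_density f
    (Finset.univ.image fun x : Σ i, Fin (Module.finrank k (V i)) => Pi.single x.1 (b x.1 x.2))
  refine ⟨a, fun i v => ?_⟩
  have : Module.toModuleEnd k (S := A) (V i) a = T i := by
    refine (b i).ext fun j => ?_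
    have h := congrFun (ha (Pi.single i (b i j))
      (Finset.mem_image.2 ⟨⟨i, j⟩, Finset.mem_univ _, rfl⟩)) i
    simpa [f] using h.symm
  exact LinearMap.congr_fun this v

end SimpleModules

/-! ### Irreducible characters and composition factors -/

section Characters

variable {k G : Type*} [Field k] [IsAlgClosed k] [Monoid G]

theorem trace_asAlgebraHom {k G V : Type*} [Field k] [Monoid G] [AddCommGroup V] [Module k V]
    (ρ : Representation k G V) (a : k[G]) :
    LinearMap.trace k V (ρ.asAlgebraHom a) = a.coeff.sum fun g c => c * ρ.character g := by
  rw [Representation.asAlgebraHom_def, MonoidAlgebra.lift_apply]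
  simp [Finsupp.sum, map_sum, Representation.character]

/-- Equivalent representations have isomorphic associated modules. -/
noncomputable def asModuleEquivOfEquiv {k G V W : Type*} [Field k] [Monoid G] [AddCommGroup V]
    [Module k V] [AddCommGroup W] [Module k W] {ρ : Representation k G V}
    {σ : Representation k G W} (e : ρ.Equiv σ) : ρ.asModule ≃ₗ[k[G]] σ.asModule :=
  LinearEquiv.ofBijective
    (Representation.IntertwiningMap.equivLinearMapAsModule ρ σ e.toIntertwiningMap) e.bijective

/-- Representations with isomorphic associated modules are equivalent. -/
noncomputable def equivOfAsModuleEquiv {k G V W : Type*} [Field k] [Monoid G] [AddCommGroup V]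
    [Module k V] [AddCommGroup W] [Module k W] {ρ : Representation k G V}
    {σ : Representation k G W} (e : ρ.asModule ≃ₗ[k[G]] σ.asModule) : ρ.Equiv σ :=
  ((Representation.IntertwiningMap.equivLinearMapAsModule ρ σ).symm e.toLinearMap).ofBijective
    e.bijective

theorem isIrreducible_of_equiv {k G V W : Type*} [Field k] [Monoid G] [AddCommGroup V]
    [Module k V] [AddCommGroup W] [Module k W] {ρ : Representation k G V}
    {σ : Representation k G W} (e : ρ.Equiv σ) (hρ : ρ.IsIrreducible) : σ.IsIrreducible := by
  rw [Representation.irreducible_iff_isSimpleModule_asModule] at hρ ⊢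
  exact IsSimpleModule.congr (asModuleEquivOfEquiv e).symm

theorem nontrivial_of_isIrreducible {k G V : Type*} [Field k] [Monoid G] [AddCommGroup V]
    [Module k V] {ρ : Representation k G V} (hρ : ρ.IsIrreducible) : Nontrivial V := by
  by_contra h
  rw [not_nontrivial_iff_subsingleton] at h
  exact bot_ne_top (α := Subrepresentation ρ) (Subrepresentation.toSubmodule_injective
    (Subsingleton.elim _ _))

/-- Density yields an element of the group algebra acting on `V i₀` by a rank-one operator of trace
1 and by 0 on the other modules; evaluating a relation there isolates one coefficient. The identity
would not do, as its trace, the dimension, may vanish in `k`. -/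
theorem linearIndependent_character {ι : Type*} {V : ι → Type*} [∀ i, AddCommGroup (V i)]
    [∀ i, Module k (V i)] [∀ i, FiniteDimensional k (V i)] (ρ : ∀ i, Representation k G (V i))
    (hρ : ∀ i, (ρ i).IsIrreducible)
    (hne : Pairwise fun i j => IsEmpty ((ρ i).Equiv (ρ j))) :
    LinearIndependent k fun i => (ρ i).character := by
  classical
  rw [linearIndependent_iff']
  intro s c hc i₀ hi₀
  have := nontrivial_of_isIrreducible (hρ i₀)
  obtain ⟨v, hv⟩ := exists_ne (0 : V i₀)
  obtain ⟨f, hf⟩ := Module.Projective.exists_dual_eq_one k hv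
  let T : ∀ i : s, V i →ₗ[k] V i := fun i =>
    if h : i.1 = i₀ then h ▸ (dualTensorHom k (V i₀) (V i₀) (f ⊗ₜ v)) else 0
  obtain ⟨a, ha⟩ := exists_smul_eq_of_pairwise_not_equiv (A := k[G])
    (V := fun i : s => (ρ i).asModule)
    (fun i j hij => ⟨fun e => (hne (Subtype.coe_injective.ne hij)).false
      (equivOfAsModuleEquiv e)⟩)
    (fun i => (ρ i).asModuleEquiv.symm.toLinearMap ∘ₗ T i ∘ₗ (ρ i).asModuleEquiv.toLinearMap)
  have hT : ∀ i : s, (ρ i).asAlgebraHom a = T i := fun i => by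
    refine LinearMap.ext fun v => ?_
    exact congrArg (ρ i).asModuleEquiv (ha i ((ρ i).asModuleEquiv.symm v))
  have h1 : ∀ i ∈ s, ∑ g ∈ a.coeff.support, a.coeff g * (ρ i).character g =
      if i = i₀ then 1 else 0 := by
    intro i hi
    have h := trace_asAlgebraHom (ρ i) a
    rw [Finsupp.sum] at h
    rw [← h, hT ⟨i, hi⟩]
    split_ifs with h
    · subst h
      simp only [T, dif_pos]
      rw [LinearMap.trace_eq_contract_apply, contractLeft_apply, hf]
    · simp only [T, dif_neg h]
      exact map_zero _
  have h2 : ∑ i ∈ s, c i * ∑ g ∈ a.coeff.support, a.coeff g * (ρ i).character g = c i₀ := by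
    rw [Finset.sum_congr rfl fun i hi => by rw [h1 i hi]]
    simp [hi₀]
  rw [← h2]
  simp only [Finset.mul_sum]
  rw [Finset.sum_comm]
  refine Finset.sum_eq_zero fun g _ => ?_
  have := congrFun hc g
  simp only [Finset.sum_apply, Pi.smul_apply, smul_eq_mul, Pi.zero_apply] at this
  calc _ = a.coeff g * ∑ i ∈ s, c i * (ρ i).character g := by
        rw [Finset.mul_sum]; exact Finset.sum_congr rfl fun i _ => by ring
    _ = 0 := by rw [this, mul_zero]

/-- Over an infinite field it suffices to evaluate at each `t`, where this is multiplicativity of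
the determinant of `t - f`. -/
theorem charpoly_eq_restrict_mul_mapQ {k V : Type*} [Field k] [Infinite k] [AddCommGroup V]
    [Module k V] [FiniteDimensional k V] (W : Submodule k V) (f : V →ₗ[k] V)
    (hf : W ≤ W.comap f) :
    f.charpoly = (f.restrict hf).charpoly * (W.mapQ W f hf).charpoly := by
  refine Polynomial.funext fun t => ?_
  rw [Polynomial.eval_mul]
  simp only [LinearMap.eval_charpoly]
  have h : W ≤ W.comap (algebraMap k (Module.End k V) t - f) := fun w hw => by
    simpa [Module.algebraMap_end_apply] using W.sub_mem (W.smul_mem t hw) (hf hw)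
  rw [LinearMap.det_eq_det_mul_det W _ h]
  congr 2
  ext x
  simp [Module.algebraMap_end_apply]

/-- A representation in a space with basis indexed by `Fin n`, transported to `Fin n → k`. -/
noncomputable def coordRep {k G V : Type*} [Field k] [Monoid G] [AddCommGroup V] [Module k V]
    {n : ℕ} (b : Module.Basis (Fin n) k V) (ρ : Representation k G V) :
    Representation k G (Fin n → k) :=
  (b.equivFun.conjRingEquiv : Module.End k V →* Module.End k (Fin n → k)).comp ρ

/-- The composition factors of a representation, seen through characteristic polynomials. -/
theorem exists_irreducible_charpoly {V : Type*} [AddCommGroup V] [Module k V]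
    [FiniteDimensional k V] (ρ : Representation k G V) :
    ∃ L : Multiset (Σ m, Representation k G (Fin m → k)), (∀ σ ∈ L, σ.2.IsIrreducible) ∧
      ∀ g, (ρ g).charpoly = (L.map fun σ => (σ.2 g).charpoly).prod := by
  have : Infinite k := IsAlgClosed.instInfinite
  induction hn : Module.finrank k V using Nat.strong_induction_on generalizing V with
  | _ n ih =>
    by_cases hirr : ρ.IsIrreducible
    · let b := Module.finBasis k V
      let σ := coordRep b ρ
      have e : ρ.Equiv σ := .mk b.equivFun fun g => by
        ext v i
        simp [σ, coordRep]
      refine ⟨{⟨_, σ⟩}, by simpa using isIrreducible_of_equiv e hirr, fun g => ?_⟩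
      simp only [Multiset.map_singleton, Multiset.prod_singleton]
      exact (b.equivFun.charpoly_conj (ρ g)).symm
    · rcases subsingleton_or_nontrivial V with hV | hV
      · refine ⟨0, by simp, fun g => ?_⟩
        have : (ρ g).charpoly.natDegree = 0 := by
          rw [LinearMap.charpoly_natDegree, Module.finrank_zero_of_subsingleton]
        simpa using (LinearMap.charpoly_monic (ρ g)).natDegree_eq_zero.1 this
      · obtain ⟨W, hW0, hW1⟩ : ∃ W : Subrepresentation ρ, W ≠ ⊥ ∧ W ≠ ⊤ := by
          by_contra! h
          have : Nontrivial (Subrepresentation ρ) := ⟨⊥, ⊤, fun h =>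
            bot_ne_top (α := Submodule k V) (congrArg Subrepresentation.toSubmodule h)⟩
          exact hirr ⟨fun W => or_iff_not_imp_left.2 (h W)⟩
        have hW0' : W.toSubmodule ≠ ⊥ := fun h => hW0 (Subrepresentation.toSubmodule_injective h)
        have hW1' : W.toSubmodule ≠ ⊤ := fun h => hW1 (Subrepresentation.toSubmodule_injective h)
        have hlt := Submodule.finrank_lt hW1'
        have hadd := W.toSubmodule.finrank_quotient_add_finrank
        have hpos : 0 < Module.finrank k W.toSubmodule := by
          rwa [Module.finrank_pos_iff, Submodule.nontrivial_iff_ne_bot]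
        have hinv : ∀ g, W.toSubmodule ≤ W.toSubmodule.comap (ρ g) := fun g v hv =>
          W.apply_mem_toSubmodule g hv
        let Q : Representation k G (V ⧸ W.toSubmodule) :=
          { toFun := fun g => W.toSubmodule.mapQ _ (ρ g) (hinv g)
            map_one' := by ext; simp
            map_mul' := fun g h => by ext; simp }
        obtain ⟨L₁, h₁, h₁'⟩ := ih _ (hn ▸ hlt) W.toRepresentation rfl
        obtain ⟨L₂, h₂, h₂'⟩ := ih _ (by omega) Q rfl
        refine ⟨L₁ + L₂, fun σ hσ => (Multiset.mem_add.1 hσ).elim (h₁ σ) (h₂ σ), fun g => ?_⟩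
        rw [Multiset.map_add, Multiset.prod_add, ← h₁', ← h₂']
        exact charpoly_eq_restrict_mul_mapQ W.toSubmodule (ρ g) (hinv g)

theorem character_eq_sum_of_charpoly_eq_prod {V : Type*} [AddCommGroup V] [Module k V]
    [FiniteDimensional k V] {ρ : Representation k G V}
    {L : Multiset (Σ m, Representation k G (Fin m → k))} {g : G}
    (h : (ρ g).charpoly = (L.map fun σ => (σ.2 g).charpoly).prod) :
    ρ.character g = (L.map fun σ => σ.2.character g).sum := by
  simp only [Representation.character,
    Module.End.trace_eq_sum_roots_charpoly_of_splits (IsAlgClosed.splits _)]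
  rw [h, Polynomial.roots_multiset_prod, Multiset.sum_bind, Multiset.map_map]
  · rfl
  · intro h0
    obtain ⟨σ, -, hσ⟩ := Multiset.mem_map.1 h0
    exact (LinearMap.charpoly_monic _).ne_zero hσ

end Characters

/-! ### Completeness of the irreducible characters in characteristic zero -/

section Completeness

variable {k G : Type*} [Field k] [IsAlgClosed k] [CharZero k] [Group G] [Fintype G]

/-- The operator `T = ∑ θ(g) ρ(g⁻¹)` commutes with `ρ` because `θ` is a class function, so it is
scalar. Its trace vanishes and its dimension is nonzero in `k`, whence `T = 0`. -/
theorem sum_mul_character_mul_inv_eq_zero {θ : G → k} (hθ : ∀ g h, θ (h * g * h⁻¹) = θ g)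
    {n : ℕ} {ρ : Representation k G (Fin n → k)} (hρ : ρ.IsIrreducible)
    (h0 : ∑ g, θ g * ρ.character g⁻¹ = 0) (h : G) :
    ∑ g, θ g * ρ.character (h * g⁻¹) = 0 := by
  let T : (Fin n → k) →ₗ[k] (Fin n → k) := ∑ g, θ g • ρ g⁻¹
  have hT : ∀ x v, T (ρ x v) = ρ x (T v) := by
    intro x v
    have h1 : ∑ g, θ g • ρ g⁻¹ (ρ x v) = ∑ g, θ (x * g * x⁻¹) • ρ (x * g * x⁻¹)⁻¹ (ρ x v) :=
      ((MulAut.conj x).toEquiv.sum_comp fun g => θ g • ρ g⁻¹ (ρ x v)).symm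
    simp only [T, LinearMap.sum_apply, LinearMap.smul_apply, map_sum, map_smul, h1]
    refine Finset.sum_congr rfl fun g _ => ?_
    rw [hθ, ← Module.End.mul_apply, ← Module.End.mul_apply, ← map_mul, ← map_mul]
    congr 3
    group
  let F : ρ.IntertwiningMap ρ := ⟨T, fun x => LinearMap.ext (hT x)⟩
  obtain ⟨c, hc⟩ :=
    Representation.IsIrreducible.algebraMap_intertwiningMap_bijective_of_isAlgClosed.2 F
  have hc' : T = c • LinearMap.id := by
    have := congrArg Representation.IntertwiningMap.toLinearMap hc
    rw [Algebra.algebraMap_eq_smul_one] at this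
    exact this.symm
  have htr : LinearMap.trace k _ T = 0 := by
    simpa [T, map_sum, Representation.character] using h0
  have hn : (n : k) ≠ 0 := by
    have := nontrivial_of_isIrreducible hρ
    have h := Module.finrank_pos (R := k) (M := Fin n → k)
    rw [Module.finrank_fin_fun] at h
    exact_mod_cast h.ne'
  have hT0 : T = 0 := by
    rw [hc', map_smul, LinearMap.trace_id, Module.finrank_fin_fun, smul_eq_mul] at htr
    rw [hc', (mul_eq_zero.1 htr).resolve_right hn, zero_smul]
  calc ∑ g, θ g * ρ.character (h * g⁻¹) = LinearMap.trace k _ (ρ h * T) := by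
        simp [T, Finset.mul_sum, map_sum, Representation.character]
    _ = 0 := by rw [hT0, mul_zero, map_zero]

/-- The right regular representation on functions. -/
def regularRep (k G : Type*) [Field k] [Group G] : Representation k G (G → k) where
  toFun g := LinearMap.funLeft k k (· * g)
  map_one' := by ext; simp [LinearMap.funLeft]
  map_mul' g h := by ext; simp [LinearMap.funLeft, mul_assoc]

theorem character_regularRep (k : Type*) {G : Type*} [Field k] [Group G] [Fintype G]
    [DecidableEq G] (g : G) :
    (regularRep k G).character g = if g = 1 then (Fintype.card G : k) else 0 := by
  rw [Representation.character, LinearMap.trace_eq_matrix_trace k (Pi.basisFun k G), Matrix.trace]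
  simp [regularRep, Pi.single_apply, LinearMap.funLeft_apply]

/-- The regular character is a sum of irreducible ones, so its translates also pair to zero with
`θ`; being `|G|` at 1 and 0 elsewhere, it returns `|G| θ(h)`. -/
theorem eq_zero_of_sum_mul_character_inv_eq_zero {θ : G → k}
    (hθ : ∀ g h, θ (h * g * h⁻¹) = θ g)
    (h0 : ∀ (n : ℕ) (ρ : Representation k G (Fin n → k)), ρ.IsIrreducible →
      ∑ g, θ g * ρ.character g⁻¹ = 0) : θ = 0 := by
  classical
  obtain ⟨L, hL, hL'⟩ := exists_irreducible_charpoly (regularRep k G)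
  funext h
  have h1 : ∑ g, θ g * (regularRep k G).character (h * g⁻¹) = 0 := by
    simp only [character_eq_sum_of_charpoly_eq_prod (hL' _)]
    rw [Finset.sum_congr rfl fun g _ => (Multiset.sum_map_mul_left (a := θ g)
      (f := fun σ : Σ m, Representation k G (Fin m → k) => σ.2.character (h * g⁻¹))).symm]
    rw [Finset.sum, Multiset.sum_map_sum_map]
    refine Multiset.sum_eq_zero fun x hx => ?_
    obtain ⟨σ, hσ, rfl⟩ := Multiset.mem_map.1 hx
    exact sum_mul_character_mul_inv_eq_zero hθ (hL σ hσ) (h0 _ _ (hL σ hσ)) h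
  simp only [character_regularRep, mul_inv_eq_one] at h1
  simpa using h1

end Completeness

/-! ### Orthonormal basis of ordinary characters -/

section Pairing

variable {G : Type*} [Group G] [Fintype G]

instance : IsAlgClosed AlgNum := (algebraicClosure.isAlgClosure ℚ ℂ).isAlgClosed

noncomputable instance : SMul AlgNum (ClassFun G) := (ClassFun G).smul

/-- The symmetric bilinear form `|G|⁻¹ ∑ g, f g * h g⁻¹` on class functions. -/
noncomputable def pairing : ClassFun G →ₗ[AlgNum] ClassFun G →ₗ[AlgNum] AlgNum :=
  LinearMap.mk₂ AlgNum (fun f h => (Nat.card G : AlgNum)⁻¹ * ∑ g, f.1 g * h.1 g⁻¹)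
    (fun a b c => by simp [add_mul, Finset.sum_add_distrib, mul_add])
    (fun r a b => by simp [Finset.mul_sum, mul_assoc, mul_left_comm])
    (fun a b c => by simp [Finset.sum_add_distrib, mul_add])
    (fun r a b => by simp [Finset.mul_sum, mul_left_comm])

theorem pairing_apply (f h : ClassFun G) :
    pairing f h = (Nat.card G : AlgNum)⁻¹ * ∑ g, f.1 g * h.1 g⁻¹ := rfl

theorem pairing_comm (f h : ClassFun G) : pairing f h = pairing h f := by
  simp only [pairing_apply]
  rw [← Equiv.sum_comp (Equiv.inv G)]
  simp [mul_comm]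

open Classical in
theorem pairing_irr (χ ψ : Irr G) : pairing χ.1 ψ.1 = if χ = ψ then 1 else 0 := by
  have : Invertible (Nat.card G : AlgNum) :=
    invertibleOfNonzero (Nat.cast_ne_zero.2 Nat.card_pos.ne')
  obtain ⟨χ, n, X, hX, rfl⟩ := χ
  obtain ⟨ψ, m, Y, hY, rfl⟩ := ψ
  have h := Representation.char_orthonormal X Y
  have h' := Representation.char_orthonormal X X
  rw [if_pos ⟨.refl X⟩] at h'
  rw [pairing_apply]
  refine h.trans ?_
  congr 1
  refine propext ⟨fun ⟨e⟩ => Subtype.ext (Subtype.ext (Representation.char_iso e).symm), fun e => ?_⟩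
  -- Equal characters of inequivalent representations would have pairing both 0 and 1.
  by_contra hne
  have e' : X.character = Y.character := congrArg (fun f => f.1.1) e
  rw [if_neg hne, ← e', h'] at h
  exact one_ne_zero h

theorem linearIndependent_irr : LinearIndependent AlgNum (fun χ : Irr G => χ.1) := by
  classical
  rw [linearIndependent_iff']
  intro s c hc χ hχ
  have := congrArg (fun f => pairing f χ.1) hc
  simpa [pairing_irr, hχ] using this

instance : Finite (Irr G) := linearIndependent_irr.finite

theorem eq_sum_pairing_irr [Fintype (Irr G)] (θ : ClassFun G) :
    θ = ∑ χ : Irr G, pairing θ χ.1 • χ.1 := by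
  classical
  rw [← sub_eq_zero]
  set η := θ - ∑ χ : Irr G, pairing θ χ.1 • χ.1 with hη
  have h : ∀ χ : Irr G, pairing η χ.1 = 0 := fun χ => by
    simp [hη, pairing_irr]
  refine Subtype.ext (eq_zero_of_sum_mul_character_inv_eq_zero η.2 fun n ρ hρ => ?_)
  have := h ⟨_, n, ρ, hρ, rfl⟩
  rw [pairing_apply] at this
  exact (mul_eq_zero.1 this).resolve_left (inv_ne_zero (Nat.cast_ne_zero.2 Nat.card_pos.ne'))

end Pairing

/-! ### The residue field and lifting of roots of unity -/

section Residue

variable (I : Ideal AlgInt)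

theorem isIntegral_algInt_iff {x : AlgNum} : IsIntegral AlgInt x ↔ IsIntegral ℤ x :=
  ⟨fun h => isIntegral_trans (R := ℤ) (A := AlgInt) x h, fun h => h.tower_top⟩

/-- Lift a monic irreducible polynomial to a monic one over `AlgInt`: its roots in `AlgNum` are
algebraic integers, and they reduce to roots. -/
instance isAlgClosed_residueField [I.IsMaximal] : IsAlgClosed (AlgInt ⧸ I) := by
  refine IsAlgClosed.of_exists_root _ fun f hf hirr => ?_
  obtain ⟨q, hq, hdeg, hmon⟩ := Polynomial.lifts_and_natDegree_eq_and_monic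
    (f := Ideal.Quotient.mk I) (p := f)
    ((Polynomial.lifts_iff_coeff_lifts _).2 fun n => Ideal.Quotient.mk_surjective _) hf
  have hq0 : (q.map (algebraMap AlgInt AlgNum)).degree ≠ 0 := by
    rw [hmon.degree_map]
    have := hirr.natDegree_pos
    rw [Polynomial.degree_eq_natDegree hmon.ne_zero]
    exact_mod_cast (hdeg.trans_ne this.ne')
  obtain ⟨x, hx⟩ := IsAlgClosed.exists_root _ hq0
  have hxq : Polynomial.eval₂ (algebraMap AlgInt AlgNum) x q = 0 := by
    rwa [Polynomial.IsRoot, Polynomial.eval_map] at hx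
  have hxi : IsIntegral ℤ x := isIntegral_algInt_iff.1 ⟨q, hmon, hxq⟩
  have h0 : q.eval ⟨x, hxi⟩ = 0 := by
    apply Subtype.coe_injective
    have := Polynomial.hom_eval₂ q (RingHom.id AlgInt) (algebraMap AlgInt AlgNum) ⟨x, hxi⟩
    exact this.trans hxq
  refine ⟨Ideal.Quotient.mk I ⟨x, hxi⟩, ?_⟩
  rw [← hq, Polynomial.eval_map, Polynomial.eval₂_hom, h0, map_zero]

variable {I} {p : ℕ}

theorem charP_residueField [I.IsMaximal] (hp : p.Prime) (hpI : (p : AlgInt) ∈ I) :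
    CharP (AlgInt ⧸ I) p := by
  have := Fact.mk hp
  refine (CharP.charP_iff_prime_eq_zero hp).2 ?_
  rw [← map_natCast (Ideal.Quotient.mk I)]
  exact Ideal.Quotient.eq_zero_iff_mem.2 hpI

/-- If `ζ ≠ ξ`, then `ζ ^ m - ξ ^ m = 0` forces the geometric sum to vanish, yet modulo `I` that sum
is `m ξ ^ (m - 1) ≠ 0`. -/
theorem eq_of_mk_eq_of_pow_eq_one [I.IsMaximal] {m : ℕ} (hm : (m : AlgInt ⧸ I) ≠ 0)
    {ζ ξ : AlgInt} (hζ : ζ ^ m = 1) (hξ : ξ ^ m = 1)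
    (h : Ideal.Quotient.mk I ζ = Ideal.Quotient.mk I ξ) : ζ = ξ := by
  by_contra hne
  have hm0 : m ≠ 0 := by rintro rfl; simp at hm
  have hgeom : (∑ i ∈ Finset.range m, ζ ^ i * ξ ^ (m - 1 - i)) * (ζ - ξ) = 0 := by
    rw [Commute.geom_sum₂_mul (Commute.all _ _), hζ, hξ, sub_self]
  have h0 := (mul_eq_zero.1 hgeom).resolve_right (sub_ne_zero.2 hne)
  have h1 := congrArg (Ideal.Quotient.mk I) h0
  rw [map_sum, map_zero] at h1
  have h2 : ∀ i ∈ Finset.range m, Ideal.Quotient.mk I (ζ ^ i * ξ ^ (m - 1 - i)) =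
      Ideal.Quotient.mk I ξ ^ (m - 1) := fun i hi => by
    rw [map_mul, map_pow, map_pow, h, ← pow_add]
    congr 1
    have := Finset.mem_range.1 hi
    omega
  rw [Finset.sum_congr rfl h2, Finset.sum_const, Finset.card_range, nsmul_eq_mul] at h1
  refine (mul_ne_zero hm (pow_ne_zero _ ?_)) h1
  intro h3
  have := congrArg (Ideal.Quotient.mk I) hξ
  rw [map_pow, h3, zero_pow hm0, map_one] at this
  exact zero_ne_one this

theorem rootLift_mk [I.IsMaximal] {m : ℕ} (hm : (m : AlgInt ⧸ I) ≠ 0) {ζ : AlgInt}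
    (hζ : ζ ^ m = 1) : rootLift I m (Ideal.Quotient.mk I ζ) = ζ := by
  have h : ∃ a ∈ {ζ : AlgInt | ζ ^ m = 1}, Ideal.Quotient.mk I a = Ideal.Quotient.mk I ζ :=
    ⟨ζ, hζ, rfl⟩
  exact eq_of_mk_eq_of_pow_eq_one hm (Function.invFunOn_mem h) hζ (Function.invFunOn_eq h)

theorem exists_pow_eq_one_mk_eq [I.IsMaximal] {m : ℕ} (hm : (m : AlgInt ⧸ I) ≠ 0)
    {x : AlgInt ⧸ I} (hx : x ^ m = 1) : ∃ ζ : AlgInt, ζ ^ m = 1 ∧ Ideal.Quotient.mk I ζ = x := by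
  have hm0 : m ≠ 0 := by rintro rfl; simp at hm
  have : NeZero m := ⟨hm0⟩
  obtain ⟨z, hz⟩ := HasEnoughRootsOfUnity.exists_primitiveRoot AlgNum m
  let ζ : AlgInt := ⟨z, hz.isIntegral (Nat.pos_of_ne_zero hm0)⟩
  have hζ : IsPrimitiveRoot ζ m :=
    IsPrimitiveRoot.of_map_of_injective (f := algebraMap AlgInt AlgNum) hz Subtype.coe_injective
  have hmk : IsPrimitiveRoot (Ideal.Quotient.mk I ζ) m := by
    refine ⟨by rw [← map_pow, hζ.pow_eq_one, map_one], fun l hl => hζ.dvd_of_pow_eq_one l ?_⟩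
    rw [← map_pow, ← map_one (Ideal.Quotient.mk I)] at hl
    refine eq_of_mk_eq_of_pow_eq_one hm ?_ (one_pow m) hl
    rw [← pow_mul, mul_comm, pow_mul, hζ.pow_eq_one, one_pow]
  obtain ⟨i, -, hi⟩ := hmk.eq_pow_of_pow_eq_one hx
  exact ⟨ζ ^ i, by rw [← pow_mul, mul_comm, pow_mul, hζ.pow_eq_one, one_pow], by rw [map_pow, hi]⟩

theorem mk_rootLift [I.IsMaximal] {m : ℕ} (hm : (m : AlgInt ⧸ I) ≠ 0)
    {x : AlgInt ⧸ I} (hx : x ^ m = 1) : Ideal.Quotient.mk I (rootLift I m x) = x := by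
  obtain ⟨ζ, hζ, rfl⟩ := exists_pow_eq_one_mk_eq hm hx
  rw [rootLift_mk hm hζ]

/-- There is a valuation ring of the algebraic numbers that contains the algebraic integers and
whose residue field is `AlgInt ⧸ I`. -/
theorem exists_valuationSubring_residue [I.IsMaximal] (hp : p.Prime) (hpI : (p : AlgInt) ∈ I) :
    ∃ (V : ValuationSubring AlgNum) (π : V →+* AlgInt ⧸ I) (hV : ∀ r : AlgInt, (r : AlgNum) ∈ V),
      ∀ r : AlgInt, π ⟨r, hV r⟩ = Ideal.Quotient.mk I r := by
  let A : Subring AlgNum := (integralClosure ℤ AlgNum).toSubring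
  obtain ⟨V, hAV, hIV⟩ := Ideal.image_subset_nonunits_valuationSubring (A := A) I
    (Ideal.IsMaximal.ne_top ‹_›)
  have hV : ∀ r : AlgInt, (r : AlgNum) ∈ V := fun r => hAV r.2
  let j : AlgInt →+* V :=
    { toFun := fun r => ⟨r, hV r⟩
      map_one' := rfl, map_mul' := fun _ _ => rfl, map_zero' := rfl, map_add' := fun _ _ => rfl }
  let κ := IsLocalRing.ResidueField V
  let f : AlgInt ⧸ I →+* κ := Ideal.Quotient.lift I ((IsLocalRing.residue V).comp j) fun a ha => by
    have h : (a : AlgNum) ∈ V.nonunits := hIV ⟨a, ha, rfl⟩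
    rw [RingHom.comp_apply, IsLocalRing.residue_eq_zero_iff]
    exact (V.mem_nonunits_iff_exists_mem_maximalIdeal.1 h).2
  let := f.toAlgebra
  have := charP_residueField hp hpI
  -- Each element of `V` is a root of a primitive integer polynomial, which stays nonzero modulo
  -- `p`. So the residue field of `V` is algebraic over the algebraically closed `AlgInt ⧸ I`, hence
  -- equal to it.
  have hint : Algebra.IsIntegral (AlgInt ⧸ I) κ := by
    refine ⟨fun y => ?_⟩
    obtain ⟨x, rfl⟩ := IsLocalRing.residue_surjective y
    rw [← isAlgebraic_iff_isIntegral]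
    obtain ⟨q₀, hq₀, hx₀⟩ := (IsFractionRing.isAlgebraic_iff ℤ ℚ AlgNum).2
      ((algebraicClosure.isAlgebraic ℚ ℂ).isAlgebraic (x : AlgNum))
    have hx : Polynomial.aeval x q₀.primPart = 0 := by
      apply Subtype.coe_injective
      have h := Polynomial.hom_eval₂ q₀.primPart (algebraMap ℤ V) (algebraMap V AlgNum) x
      exact h.trans (Polynomial.aeval_primPart_eq_zero hq₀ hx₀)
    refine ⟨q₀.primPart.map (Int.castRingHom _), fun h0 => ?_, ?_⟩
    · have hdvd : Polynomial.C (p : ℤ) ∣ q₀.primPart := by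
        refine (Polynomial.C_dvd_iff_dvd_coeff _ _).2 fun i => ?_
        have := congrArg (Polynomial.coeff · i) h0
        simpa [Polynomial.coeff_map, CharP.intCast_eq_zero_iff _ p] using this
      have h1 := q₀.isPrimitive_primPart _ hdvd
      rw [Int.isUnit_iff_natAbs_eq, Int.natAbs_natCast] at h1
      exact hp.one_lt.ne' h1
    · rw [Polynomial.aeval_def, Polynomial.eval₂_map, RingHom.ext_int (RingHom.comp _ _)
        ((IsLocalRing.residue V).comp (algebraMap ℤ V)), ← Polynomial.hom_eval₂]
      exact (congrArg _ hx).trans (map_zero _)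
  have hbij := IsAlgClosed.algebraMap_bijective_of_isIntegral (k := AlgInt ⧸ I) (K := κ)
  let e := RingEquiv.ofBijective f hbij
  refine ⟨V, (e.symm : κ →+* AlgInt ⧸ I).comp (IsLocalRing.residue V), hV, fun r => ?_⟩
  exact e.symm_apply_apply (Ideal.Quotient.mk I r)

end Residue

/-! ### Traces in characteristic p and the p-regular part -/

section FrobeniusTrace

variable {k : Type*} [Field k] (p : ℕ) [Fact p.Prime] [CharP k p]

/-- After substituting `X ^ p` for `X`, both sides become `det (X - M) ^ p`, since `X ^ p - M ^ p =
(X - M) ^ p`. -/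
theorem matrix_charpoly_pow_char {n : Type*} [Fintype n] [DecidableEq n] (M : Matrix n n k) :
    (M ^ p).charpoly = M.charpoly.map (frobenius k p) := by
  cases isEmpty_or_nonempty n
  · simp [Matrix.charpoly]
  apply Polynomial.expand_injective (R := k) (Fact.out : p.Prime).pos
  rw [← Polynomial.map_expand, Polynomial.map_frobenius_expand]
  unfold Matrix.charpoly
  rw [AlgHom.map_det, ← Matrix.coe_detMonoidHom,
    ← (Matrix.detMonoidHom : Matrix n n k[X] →* k[X]).map_pow]
  apply congr_arg Matrix.det
  refine matPolyEquiv.injective ?_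
  rw [map_pow, Matrix.matPolyEquiv_charmatrix, sub_pow_char_of_commute, ← Polynomial.C_pow]
  · exact (id (_root_.matPolyEquiv_eq_X_pow_sub_C p M) :)
  · exact (Polynomial.C M).commute_X

theorem trace_pow_char {n : Type*} [Fintype n] [DecidableEq n] (M : Matrix n n k) :
    (M ^ p).trace = M.trace ^ p := by
  cases isEmpty_or_nonempty n
  · simp [Matrix.trace, (Fact.out : p.Prime).ne_zero]
  rw [Matrix.trace_eq_neg_charpoly_coeff, Matrix.trace_eq_neg_charpoly_coeff,
    matrix_charpoly_pow_char, Polynomial.coeff_map, ← map_neg, frobenius_def]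

theorem character_pow_char_pow {G : Type*} [Monoid G] {n : ℕ} (ρ : Representation k G (Fin n → k))
    (g : G) (a : ℕ) : ρ.character (g ^ p ^ a) = ρ.character g ^ p ^ a := by
  induction a with
  | zero => simp
  | succ a ih =>
    rw [pow_succ, pow_mul, pow_mul, ← ih, Representation.character, Representation.character,
      map_pow, LinearMap.trace_eq_matrix_trace k (Pi.basisFun k (Fin n)),
      LinearMap.trace_eq_matrix_trace k (Pi.basisFun k (Fin n)), ← LinearMap.toMatrix_pow,
      trace_pow_char]

/-- A character in characteristic `p` takes at `g` the same value as at its `p`-regular part. -/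
theorem exists_isPRegular_character_eq {G : Type*} [Group G] [Finite G] (g : G) :
    ∃ s : G, IsPRegular p s ∧ ∀ (n : ℕ) (ρ : Representation k G (Fin n → k)),
      ρ.character s = ρ.character g := by
  have hp : p.Prime := Fact.out
  set m := ordCompl[p] (orderOf g) with hm
  have ho : orderOf g ≠ 0 := (orderOf_pos g).ne'
  have hcop : Nat.Coprime p m := Nat.coprime_ordCompl hp ho
  have hm0 : 0 < m := Nat.ordCompl_pos p ho
  set e := (orderOf g).factorization p with he
  -- Chosen so that `p ^ t` is 1 modulo `m` and divisible by `p ^ e`: then `s = g ^ p ^ t` has order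
  -- prime to `p` and satisfies `s ^ p ^ t = s`.
  set t := m.totient * (e + 1) with ht
  have h1 : p ^ t ≡ 1 [MOD m] := by
    rw [ht, pow_mul]
    simpa using (Nat.ModEq.pow_totient hcop).pow (e + 1)
  have hle : e ≤ t := by
    have := Nat.totient_pos.2 hm0
    nlinarith
  have horder : orderOf g = p ^ e * m := (Nat.ordProj_mul_ordCompl_eq_self _ _).symm
  have hidem : g ^ (p ^ t * p ^ t) = g ^ p ^ t := by
    rw [pow_eq_pow_iff_modEq, horder]
    have h2 : p ^ t = p ^ e * p ^ (t - e) := by rw [← pow_add, Nat.add_sub_cancel' hle]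
    have h3 : p ^ (t - e) * p ^ t ≡ p ^ (t - e) [MOD m] := by simpa using h1.mul_left (p ^ (t - e))
    have h4 := h3.mul_left' (p ^ e)
    rwa [← mul_assoc, ← h2] at h4
  refine ⟨g ^ p ^ t, ?_, fun n ρ => ?_⟩
  · intro hdvd
    have h5 : (g ^ p ^ t) ^ m = 1 := by
      rw [← pow_mul, ← orderOf_dvd_iff_pow_eq_one, horder]
      exact Nat.mul_dvd_mul_right (pow_dvd_pow p hle) m
    have h6 := hdvd.trans (orderOf_dvd_of_pow_eq_one h5)
    exact hp.one_lt.ne' (Nat.dvd_one.1 (hcop ▸ Nat.dvd_gcd dvd_rfl h6))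
  -- The values at `s` and `g` have the same `p ^ t`-th power, and Frobenius is injective.
  · have h7 := character_pow_char_pow p ρ (g ^ p ^ t) t
    rw [← pow_mul, hidem] at h7
    have h8 := character_pow_char_pow p ρ g t
    have h9 : ρ.character (g ^ p ^ t) ^ p ^ t = ρ.character g ^ p ^ t := by rw [← h7, h8]
    exact iterateFrobenius_inj k p t h9

end FrobeniusTrace

/-! ### Integral forms over a valuation ring -/

/-- A representation of a finite group over the field of fractions of a valuation ring can be
realized over the valuation ring. -/
theorem exists_integral_form {K G : Type*} [Field K] [Group G] [Finite G] (V : ValuationSubring K)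
    {n : ℕ} (X : Representation K G (Fin n → K)) :
    ∃ (m : ℕ) (Y : G →* Matrix (Fin m) (Fin m) V),
      ∀ g, (X g).charpoly = ((Y g).map (algebraMap V K)).charpoly := by
  -- The lattice spanned by the `G`-orbits of the standard basis is finitely generated and
  -- torsion-free, hence free over the valuation ring; a `V`-basis of it is a `K`-basis of the whole
  -- space.
  let M : Submodule V (Fin n → K) :=
    Submodule.span V (Set.range fun x : G × Fin n => X x.1 (Pi.single x.2 1))
  have : Module.Finite V M := Module.Finite.span_of_finite V (Set.finite_range _)
  have : Module.Flat V M := by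
    rw [Module.Flat.flat_iff_torsion_eq_bot_of_isBezout, ← Submodule.isTorsionFree_iff_torsion_eq_bot]
    infer_instance
  have : Module.Free V M := Module.free_of_flat_of_isLocalRing
  have hM : ∀ g, ∀ v ∈ M, (X g).restrictScalars V v ∈ M := by
    intro g
    change M ≤ M.comap ((X g).restrictScalars V)
    rw [Submodule.span_le]
    rintro _ ⟨⟨h, i⟩, rfl⟩
    refine Submodule.subset_span ⟨⟨g * h, i⟩, ?_⟩
    simp
  let ρ : G →* Module.End V M :=
    { toFun := fun g => ((X g).restrictScalars V).restrict (hM g)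
      map_one' := by ext; simp
      map_mul' := fun g h => by ext; simp }
  let b := Module.finBasis V M
  have hli : LinearIndependent K (fun i => (b i : Fin n → K)) := by
    rw [← LinearIndependent.iff_fractionRing V K]
    exact b.linearIndependent.map' M.subtype M.ker_subtype
  have hsp : ⊤ ≤ Submodule.span K (Set.range fun i => (b i : Fin n → K)) := by
    have hMle : M ≤ (Submodule.span K (Set.range fun i => (b i : Fin n → K))).restrictScalars V := by
      intro v hv
      have h := b.sum_repr ⟨v, hv⟩
      have h' := congrArg M.subtype h
      rw [map_sum] at h'
      rw [show v = M.subtype ⟨v, hv⟩ from rfl, ← h']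
      refine Submodule.sum_mem _ fun i _ => ?_
      rw [map_smul]
      exact Submodule.smul_mem _ _ (Submodule.subset_span ⟨i, rfl⟩)
    rw [← (Pi.basisFun K (Fin n)).span_eq, Submodule.span_le]
    rintro _ ⟨i, rfl⟩
    refine hMle (Submodule.subset_span ⟨⟨1, i⟩, ?_⟩)
    simp
  let B := Module.Basis.mk hli hsp
  refine ⟨_, (MonoidHomClass.toMonoidHom (LinearMap.toMatrixAlgEquiv b)).comp ρ, fun g => ?_⟩
  rw [← LinearMap.charpoly_toMatrix (X g) B]
  congr 1
  refine (LinearEquiv.eq_symm_apply (LinearMap.toMatrix B B)).1 (B.ext fun j => ?_)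
  rw [LinearMap.toMatrix_symm, Matrix.toLin_self]
  have h := congrArg M.subtype (b.sum_repr (ρ g (b j)))
  rw [map_sum] at h
  rw [show X g (B j) = M.subtype (ρ g (b j)) by simp [B, ρ], ← h]
  refine Finset.sum_congr rfl fun i _ => ?_
  simp [B, LinearMap.toMatrixAlgEquiv_apply]
  rfl

/-! ### Brauer characters and reduction of ordinary characters -/

section BrauerCharacters

variable {G : Type*} [Group G] {p : ℕ} {I : Ideal AlgInt} [I.IsMaximal]

theorem natCast_ordCompl_ne_zero [Finite G] (hp : p.Prime) (hpI : (p : AlgInt) ∈ I) :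
    ((ordCompl[p] (Nat.card G) : ℕ) : AlgInt ⧸ I) ≠ 0 := by
  have := charP_residueField hp hpI
  rw [Ne, CharP.cast_eq_zero_iff _ p]
  exact Nat.not_dvd_ordCompl hp Nat.card_pos.ne'

theorem pow_ordCompl_eq_one [Finite G] (hp : p.Prime) {g : G} (hg : IsPRegular p g) :
    g ^ ordCompl[p] (Nat.card G) = 1 := by
  rw [← orderOf_dvd_iff_pow_eq_one]
  have h : orderOf g ∣ ordProj[p] (Nat.card G) * ordCompl[p] (Nat.card G) := by
    rw [Nat.ordProj_mul_ordCompl_eq_self]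
    exact orderOf_dvd_natCard g
  exact Nat.Coprime.dvd_of_dvd_mul_left
    (((Nat.Prime.coprime_iff_not_dvd hp).2 hg).symm.pow_right _) h

theorem pow_eq_one_of_mem_roots_charpoly {k : Type*} [Field k] {n m : ℕ}
    (X : Representation k G (Fin n → k)) {g : G} (hg : g ^ m = 1) {x : k}
    (hx : x ∈ (X g).charpoly.roots) : x ^ m = 1 := by
  have h := Polynomial.isRoot_of_mem_roots hx
  rw [← Module.End.hasEigenvalue_iff_isRoot_charpoly] at h
  obtain ⟨v, hv⟩ := h.exists_hasEigenvector
  have h1 := hv.pow_apply m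
  rw [← map_pow, hg, map_one, Module.End.one_apply] at h1
  have h2 : (x ^ m - 1) • v = 0 := by rw [sub_smul, ← h1, one_smul, sub_self]
  exact sub_eq_zero.1 ((smul_eq_zero.1 h2).resolve_right hv.2)

theorem brauerChar_apply_of_isPRegular {n : ℕ}
    (X : Representation (AlgInt ⧸ I) G (Fin n → AlgInt ⧸ I)) {g : G} (hg : IsPRegular p g) :
    (brauerChar p I X).1 g = (((X g).charpoly.roots.map
      fun x => rootLift I (ordCompl[p] (Nat.card G)) x).sum : AlgInt) := by
  refine (if_pos hg).trans ?_
  rw [← Subalgebra.coe_val, map_multiset_sum, Multiset.map_map]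
  rfl

theorem brauerChar_apply_of_not_isPRegular {n : ℕ}
    (X : Representation (AlgInt ⧸ I) G (Fin n → AlgInt ⧸ I)) {g : G} (hg : ¬ IsPRegular p g) :
    (brauerChar p I X).1 g = 0 := if_neg hg

theorem exists_brauerChar_eq_mk_eq [Finite G] (hp : p.Prime) (hpI : (p : AlgInt) ∈ I) {n : ℕ}
    (X : Representation (AlgInt ⧸ I) G (Fin n → AlgInt ⧸ I)) {g : G} (hg : IsPRegular p g) :
    ∃ r : AlgInt, (brauerChar p I X).1 g = r ∧ Ideal.Quotient.mk I r = X.character g := by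
  refine ⟨_, brauerChar_apply_of_isPRegular X hg, ?_⟩
  rw [Representation.character,
    Module.End.trace_eq_sum_roots_charpoly_of_splits (IsAlgClosed.splits _), map_multiset_sum,
    Multiset.map_map]
  conv_rhs => rw [← Multiset.map_id (X g).charpoly.roots]
  congr 1
  exact Multiset.map_congr rfl fun x hx => mk_rootLift (natCast_ordCompl_ne_zero hp hpI)
    (pow_eq_one_of_mem_roots_charpoly X (pow_ordCompl_eq_one hp hg) hx)

theorem decompMap_brauerChar {n : ℕ}
    (X : Representation (AlgInt ⧸ I) G (Fin n → AlgInt ⧸ I)) :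
    decompMap p (brauerChar p I X) = brauerChar p I X := by
  refine Subtype.ext (funext fun g => ?_)
  by_cases hg : IsPRegular p g
  · exact if_pos hg
  · exact (if_neg hg).trans (brauerChar_apply_of_not_isPRegular X hg).symm

theorem brauerChar_eq_of_equiv {n m : ℕ} {X : Representation (AlgInt ⧸ I) G (Fin n → AlgInt ⧸ I)}
    {Y : Representation (AlgInt ⧸ I) G (Fin m → AlgInt ⧸ I)} (e : X.Equiv Y) :
    brauerChar p I X = brauerChar p I Y := by
  refine Subtype.ext (funext fun g => ?_)
  have h : (X g).charpoly = (Y g).charpoly := by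
    rw [← e.toLinearEquiv.charpoly_conj]
    congr 1
    exact e.conj_apply_self g
  simp only [brauerChar, h]

theorem brauerChar_eq_sum {n : ℕ} {X : Representation (AlgInt ⧸ I) G (Fin n → AlgInt ⧸ I)}
    {L : Multiset (Σ m, Representation (AlgInt ⧸ I) G (Fin m → AlgInt ⧸ I))}
    (h : ∀ g, (X g).charpoly = (L.map fun σ => (σ.2 g).charpoly).prod) :
    brauerChar p I X = (L.map fun σ => brauerChar p I σ.2).sum := by
  refine Subtype.ext (funext fun g => ?_)
  let ev : ClassFun G →ₗ[AlgNum] AlgNum := LinearMap.proj g ∘ₗ (ClassFun G).subtype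
  change ev (brauerChar p I X) = ev (L.map fun σ => brauerChar p I σ.2).sum
  rw [map_multiset_sum, Multiset.map_map]
  by_cases hg : IsPRegular p g
  · have h0 : (0 : Polynomial (AlgInt ⧸ I)) ∉ L.map fun σ => (σ.2 g).charpoly := by
      intro h0
      obtain ⟨σ, -, hσ⟩ := Multiset.mem_map.1 h0
      exact (LinearMap.charpoly_monic _).ne_zero hσ
    have h1 : ∀ {n : ℕ} (Y : Representation (AlgInt ⧸ I) G (Fin n → AlgInt ⧸ I)),
        ev (brauerChar p I Y) = ((Y g).charpoly.roots.map
          fun x => (rootLift I (ordCompl[p] (Nat.card G)) x : AlgNum)).sum := fun Y => if_pos hg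
    rw [h1, h, Polynomial.roots_multiset_prod _ h0, Multiset.map_bind, Multiset.sum_bind,
      Multiset.map_map]
    exact congrArg _ (Multiset.map_congr rfl fun σ _ => (h1 σ.2).symm)
  · rw [show ev _ = 0 from brauerChar_apply_of_not_isPRegular X hg]
    symm
    refine Multiset.sum_eq_zero fun x hx => ?_
    obtain ⟨σ, -, rfl⟩ := Multiset.mem_map.1 hx
    exact brauerChar_apply_of_not_isPRegular σ.2 hg

theorem exists_brauerChar_eq_decompMap [Finite G] (hp : p.Prime) (hpI : (p : AlgInt) ∈ I) {n : ℕ}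
    (X : Representation AlgNum G (Fin n → AlgNum)) :
    ∃ (m : ℕ) (Y : Representation (AlgInt ⧸ I) G (Fin m → AlgInt ⧸ I)),
      decompMap p (ordinaryChar X) = brauerChar p I Y := by
  obtain ⟨V, π, hV, hπ⟩ := exists_valuationSubring_residue hp hpI
  obtain ⟨m, Z, hZ⟩ := exists_integral_form V X
  let Y : Representation (AlgInt ⧸ I) G (Fin m → AlgInt ⧸ I) :=
    (MonoidHomClass.toMonoidHom (Matrix.toLinAlgEquiv' (R := AlgInt ⧸ I) (n := Fin m))).comp
      (π.mapMatrix.toMonoidHom.comp Z)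
  have hY : ∀ g, (Y g).charpoly = (Z g).charpoly.map π := fun g => by
    rw [← Matrix.charpoly_map]
    exact Matrix.charpoly_toLin' _
  refine ⟨m, Y, Subtype.ext (funext fun g => ?_)⟩
  by_cases hg : IsPRegular p g
  swap
  · exact (if_neg hg).trans (brauerChar_apply_of_not_isPRegular Y hg).symm
  refine (if_pos hg).trans ?_
  rw [brauerChar_apply_of_isPRegular Y hg]
  have hroot : ∀ x ∈ (X g).charpoly.roots, x ^ ordCompl[p] (Nat.card G) = 1 := fun x hx =>
    pow_eq_one_of_mem_roots_charpoly X (pow_ordCompl_eq_one hp hg) hx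
  have hpos : 0 < ordCompl[p] (Nat.card G) := Nat.ordCompl_pos p Nat.card_pos.ne'
  have hint : ∀ x ∈ (X g).charpoly.roots, x ∈ integralClosure ℤ AlgNum := fun x hx =>
    IsIntegral.of_pow hpos (by rw [hroot x hx]; exact isIntegral_one)
  let s : Multiset AlgInt := (X g).charpoly.roots.pmap (fun x hx => (⟨x, hx⟩ : AlgInt)) hint
  have hs : s.map (fun ζ : AlgInt => (ζ : AlgNum)) = (X g).charpoly.roots := by
    simp only [s, Multiset.map_pmap]
    exact (Multiset.pmap_eq_map _ _ _ _).trans (Multiset.map_id _)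
  have hs1 : ∀ ζ ∈ s, ζ ^ ordCompl[p] (Nat.card G) = 1 := fun ζ hζ => by
    apply Subtype.coe_injective
    have : (ζ : AlgNum) ∈ (X g).charpoly.roots := hs ▸ Multiset.mem_map_of_mem _ hζ
    exact hroot _ this
  -- The eigenvalues are algebraic integers, so the characteristic polynomial already splits over
  -- `V`; its reduction then has the reduced eigenvalues as roots, and `rootLift` recovers the
  -- originals.
  have hZs : (Z g).charpoly =
      (s.map fun ζ : AlgInt => Polynomial.X - Polynomial.C (⟨ζ, hV ζ⟩ : V)).prod := by
    apply Polynomial.map_injective (algebraMap V AlgNum) Subtype.coe_injective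
    rw [← Matrix.charpoly_map, ← hZ, Polynomial.map_multiset_prod, Multiset.map_map,
      (IsAlgClosed.splits (X g).charpoly).eq_prod_roots_of_monic (LinearMap.charpoly_monic _), ← hs,
      Multiset.map_map]
    congr 1
    refine Multiset.map_congr rfl fun ζ _ => ?_
    simp only [Function.comp_apply, Polynomial.map_sub, Polynomial.map_X, Polynomial.map_C]
    rfl
  have hYs : (Y g).charpoly.roots = s.map (Ideal.Quotient.mk I) := by
    rw [hY, hZs, Polynomial.map_multiset_prod, Multiset.map_map,
      ← Polynomial.roots_multiset_prod_X_sub_C (s.map (Ideal.Quotient.mk I)), Multiset.map_map]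
    congr 2
    refine Multiset.map_congr rfl fun ζ _ => ?_
    simp [hπ]
  rw [hYs, Multiset.map_map]
  have hsum : (s.map ((fun x => rootLift I (ordCompl[p] (Nat.card G)) x) ∘
      Ideal.Quotient.mk I)).sum = s.sum := by
    conv_rhs => rw [← Multiset.map_id s]
    exact congrArg _ (Multiset.map_congr rfl fun ζ hζ =>
      rootLift_mk (natCast_ordCompl_ne_zero hp hpI) (hs1 ζ hζ))
  rw [hsum, ← Subalgebra.coe_val, map_multiset_sum]
  refine (Module.End.trace_eq_sum_roots_charpoly_of_splits (IsAlgClosed.splits _)).trans ?_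
  exact congrArg _ hs.symm

/-- Count the composition factors of the reduced representation. Hence the default value in
`decompNumber` is never taken. -/
theorem exists_decompMap_eq_sum [Finite G] (hp : p.Prime) (hpI : (p : AlgInt) ∈ I) (χ : Irr G) :
    ∃ d : IBr G p I →₀ ℕ, decompMap p χ.1 = d.sum fun φ k => k • φ.1 := by
  obtain ⟨χ, n, X, hX, rfl⟩ := χ
  obtain ⟨m, Y, hY⟩ := exists_brauerChar_eq_decompMap hp hpI X
  obtain ⟨L, hL, hL'⟩ := exists_irreducible_charpoly Y
  simp only [hY, brauerChar_eq_sum hL']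
  clear hL' hY
  induction L using Multiset.induction with
  | empty => exact ⟨0, by simp⟩
  | cons σ L ih =>
    obtain ⟨d, hd⟩ := ih fun τ hτ => hL τ (Multiset.mem_cons_of_mem hτ)
    let φ : IBr G p I := ⟨brauerChar p I σ.2, _, σ.2, hL σ (Multiset.mem_cons_self _ _), rfl⟩
    refine ⟨Finsupp.single φ 1 + d, ?_⟩
    rw [Multiset.map_cons, Multiset.sum_cons, hd, Finsupp.sum_add_index', Finsupp.sum_single_index]
    · simp [φ]
    · simp
    · simp
    · intro a b c; exact add_smul _ _ _

end BrauerCharacters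

/-- Vectors over a ring are independent over its field of fractions if their reductions are
independent over a residue field. -/
theorem linearIndependent_of_reduction {R K F ι S : Type*} [CommRing R] [Field K] [Field F]
    [Fintype ι] [Finite S] {j : R →+* K} (hj : Function.Injective j) {π : R →+* F}
    (hπ : Function.Surjective π) (A : Matrix ι S R)
    (h : LinearIndependent F fun i => (A.map π) i) : LinearIndependent K fun i => (A.map j) i := by
  classical
  have := Fintype.ofFinite S
  obtain ⟨B, hB⟩ : ∃ B : Matrix S ι F, A.map π * B = 1 := by
    have hinj : LinearMap.ker (A.map π).vecMulLinear = ⊥ := by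
      rw [LinearMap.ker_eq_bot]
      exact Matrix.vecMul_injective_iff.2 h
    obtain ⟨f, hf⟩ := LinearMap.exists_leftInverse_of_injective _ hinj
    refine ⟨(LinearMap.toMatrix' f).transpose, ?_⟩
    have h1 := congrArg LinearMap.toMatrix' hf
    rw [LinearMap.toMatrix'_comp, LinearMap.toMatrix'_id] at h1
    have h2 : LinearMap.toMatrix' (A.map π).vecMulLinear = (A.map π).transpose := by
      ext i j
      simp [LinearMap.toMatrix'_apply]
    rw [h2] at h1
    rw [← Matrix.transpose_inj, Matrix.transpose_mul, Matrix.transpose_transpose, h1,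
      Matrix.transpose_one]
  choose s hs using hπ
  -- The right inverse of the reduction is lifted entrywise: `det (A * C)` reduces to 1, so it is
  -- nonzero in `R` and hence in `K`.
  let C : Matrix S ι R := B.map s
  have hC : C.map π = B := by ext; simp [C, hs]
  have hdet : (A * C).det ≠ 0 := by
    intro h0
    have h1 := congrArg π h0
    rw [RingHom.map_det, RingHom.mapMatrix_apply, Matrix.map_mul, hC, hB, Matrix.det_one,
      map_zero] at h1
    exact one_ne_zero h1
  have hdet' : (A.map j * C.map j).det ≠ 0 := by
    rw [← Matrix.map_mul, ← RingHom.mapMatrix_apply, ← RingHom.map_det]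
    exact fun h0 => hdet (hj (h0.trans (map_zero j).symm))
  rw [← Matrix.row_def, ← Matrix.vecMul_injective_iff]
  refine (injective_iff_map_eq_zero (A.map j).vecMulLinear).2 fun v hv => ?_
  refine Matrix.eq_zero_of_vecMul_eq_zero hdet' ?_
  rw [← Matrix.vecMul_vecMul]
  exact (congrArg (Matrix.vecMul · (C.map j)) hv).trans (Matrix.zero_vecMul _)

/-! ### Independence of Brauer characters, duality and blocks -/

section Decomposition

variable {G : Type*} [Group G] {p : ℕ} {I : Ideal AlgInt} [I.IsMaximal]

theorem linearIndependent_ibr [Finite G] (hp : p.Prime) (hpI : (p : AlgInt) ∈ I) :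
    LinearIndependent AlgNum (fun φ : IBr G p I => φ.1) := by
  have := Fact.mk hp
  have := charP_residueField hp hpI
  choose n X hX hφ using fun φ : IBr G p I => φ.2
  have hne : Pairwise fun φ ψ => IsEmpty ((X φ).Equiv (X ψ)) := fun φ ψ hφψ =>
    ⟨fun e => hφψ (Subtype.ext ((hφ φ).trans ((brauerChar_eq_of_equiv e).trans (hφ ψ).symm)))⟩
  have hchar := linearIndependent_character X hX hne
  let S := {g : G // IsPRegular p g}
  -- Values on `p`-regular elements determine all values, so a relation there holds on all of `G`.
  have hreg : LinearIndependent (AlgInt ⧸ I) fun (φ : IBr G p I) (g : S) =>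
      (X φ).character g := by
    rw [linearIndependent_iff'] at hchar ⊢
    refine fun s c hc => hchar s c (funext fun g => ?_)
    obtain ⟨t, ht, htg⟩ := exists_isPRegular_character_eq (k := AlgInt ⧸ I) p g
    have := congrFun hc ⟨t, ht⟩
    simpa [htg] using this
  choose r hr hr' using fun (φ : IBr G p I) (g : S) => exists_brauerChar_eq_mk_eq hp hpI (X φ) g.2
  -- The determinant argument needs finite families; finiteness of `IBr` is only a consequence.
  rw [linearIndependent_iff_finset_linearIndependent] at hreg ⊢
  intro s
  have hA : (fun φ : s => ((Matrix.of fun (φ : s) (g : S) => r φ g).map (Ideal.Quotient.mk I)) φ) =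
      (fun (φ : IBr G p I) (g : S) => (X φ).character g) ∘ Subtype.val := by
    ext φ g
    exact hr' _ _
  have h := linearIndependent_of_reduction (j := algebraMap AlgInt AlgNum) (π := Ideal.Quotient.mk I)
    Subtype.coe_injective Ideal.Quotient.mk_surjective (Matrix.of fun (φ : s) (g : S) => r φ g)
    (by rw [hA]; exact hreg s)
  let res : ClassFun G →ₗ[AlgNum] (S → AlgNum) :=
    LinearMap.funLeft AlgNum AlgNum (Subtype.val : S → G) ∘ₗ (ClassFun G).subtype
  refine LinearIndependent.of_comp res ?_
  convert h using 2 with φ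
  ext1 g
  change (φ : IBr G p I).1.1 g = _
  rw [hφ]
  exact hr _ _

theorem finite_ibr [Finite G] (hp : p.Prime) (hpI : (p : AlgInt) ∈ I) : Finite (IBr G p I) :=
  (linearIndependent_ibr hp hpI).finite

theorem decompMap_eq_sum_decompNumber [Finite G] [Fintype (IBr G p I)] (hp : p.Prime)
    (hpI : (p : AlgInt) ∈ I) (χ : Irr G) :
    decompMap p χ.1 = ∑ φ : IBr G p I, (decompNumber p I χ φ : AlgNum) • φ.1 := by
  have h := exists_decompMap_eq_sum hp hpI χ
  have h1 : decompNumber p I χ = h.choose := dif_pos h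
  rw [h.choose_spec, ← h1, Finsupp.sum_fintype _ _ (by simp)]
  simp only [Nat.cast_smul_eq_nsmul]

open Classical in
/-- Irreducible Brauer characters are dual to the projective indecomposable characters. -/
theorem sum_decompNumber_mul_pairing [Fintype G] [Fintype (Irr G)] (hp : p.Prime)
    (hpI : (p : AlgInt) ∈ I) (φ ψ : IBr G p I) :
    ∑ χ : Irr G, (decompNumber p I χ φ : AlgNum) * pairing χ.1 ψ.1 = if ψ = φ then 1 else 0 := by
  have := finite_ibr (G := G) hp hpI
  have := Fintype.ofFinite (IBr G p I)
  have hψ : decompMap p ψ.1 = ψ.1 := by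
    obtain ⟨ψ, n, X, hX, rfl⟩ := ψ
    exact decompMap_brauerChar X
  have h : ∑ φ : IBr G p I, (∑ χ : Irr G, (decompNumber p I χ φ : AlgNum) * pairing χ.1 ψ.1) • φ.1 =
      ∑ φ : IBr G p I, (if ψ = φ then (1 : AlgNum) else 0) • φ.1 := by
    have h1 : ∑ φ : IBr G p I, (if ψ = φ then (1 : AlgNum) else 0) • φ.1 = ψ.1 := by simp
    rw [h1, ← hψ]
    conv_rhs => rw [eq_sum_pairing_irr ψ.1, map_sum]
    simp only [map_smul, decompMap_eq_sum_decompNumber hp hpI, Finset.smul_sum, Finset.sum_smul]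
    rw [Finset.sum_comm]
    refine Finset.sum_congr rfl fun χ _ => Finset.sum_congr rfl fun θ _ => ?_
    rw [smul_smul, mul_comm, pairing_comm, hψ]
  exact Fintype.linearIndependent_iffₛ.1 (linearIndependent_ibr hp hpI) _ _ h φ

/-- Some `ψ` in `B` also contains `φ`, so `χ` equals `ψ` or is adjacent to it. Here it matters that
`B` consists of whole blocks. -/
theorem mem_irrOf_of_decompNumber_ne_zero {B : Set (Block G p I)} {φ : IBr G p I}
    (hφ : φ.1 ∈ IBrOf B) {χ : Irr G} (hχ : decompNumber p I χ φ ≠ 0) : χ.1 ∈ IrrOf B := by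
  obtain ⟨_, ψ, ⟨hψ, hψB⟩, hd⟩ := hφ
  refine ⟨χ.2, ?_⟩
  by_cases hne : χ = ψ
  · rwa [hne]
  · have hadj : (brauerGraph G p I).Adj χ ψ :=
      (SimpleGraph.fromRel_adj _ _ _).2 ⟨hne, Or.inl ⟨φ, hχ, hd⟩⟩
    rwa [SimpleGraph.ConnectedComponent.sound hadj.reachable]

theorem irrOf_eq_image (B : Set (Block G p I)) : IrrOf B = Subtype.val '' {χ : Irr G | χ.1 ∈ IrrOf B} := by
  ext χ
  exact ⟨fun h => ⟨⟨χ, h.1⟩, h, rfl⟩, by rintro ⟨χ, h, rfl⟩; exact h⟩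

end Decomposition

/-! ### Counting fixed points -/

section Counting

variable {G : Type*} [Group G] [Fintype G]

/-- The complex conjugation in `inner` is harmless because a natural number is fixed by it. -/
theorem inner_trivialChar_eq_natCast {f : ClassFun G} {n : ℕ}
    (h : (Nat.card G : AlgNum)⁻¹ * ∑ g, f.1 g = n) : inner (trivialChar G) f = n := by
  have h1 := congrArg (fun x : AlgNum => starRingEnd ℂ (x : ℂ)) h
  simp only [IntermediateField.coe_mul, IntermediateField.coe_inv, IntermediateField.coe_sum,
    map_mul, map_inv₀, map_sum] at h1
  simpa [inner, trivialChar] using h1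

/-- Both sides restrict the sum to `p`-regular elements, a set closed under inversion. -/
theorem pairing_decompMap_left (p : ℕ) (f h : ClassFun G) :
    pairing (decompMap p f) h = pairing f (decompMap p h) := by
  classical
  rw [pairing_apply, pairing_apply]
  congr 1
  refine Finset.sum_congr rfl fun g _ => ?_
  by_cases hg : IsPRegular p g
  · have hg' : IsPRegular p g⁻¹ := by rwa [IsPRegular, orderOf_inv]
    rw [show (decompMap p f).1 g = f.1 g from if_pos hg,
      show (decompMap p h).1 g⁻¹ = h.1 g⁻¹ from if_pos hg']
  · have hg' : ¬ IsPRegular p g⁻¹ := by rwa [IsPRegular, orderOf_inv]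
    rw [show (decompMap p f).1 g = 0 from if_neg hg,
      show (decompMap p h).1 g⁻¹ = 0 from if_neg hg', zero_mul, mul_zero]

variable {p : ℕ} {I : Ideal AlgInt} [I.IsMaximal] (B : Set (Block G p I))
  (α : ClassFun G →ₗ[AlgNum] ClassFun G)

open Classical in
theorem twistedSum_apply [Fintype (Irr G)] (g : G) :
    (twistedSum B α).1 g =
      ∑ χ : Irr G with χ.1 ∈ IrrOf B, χ.1.1 g * (α χ.1).1 g⁻¹ := by
  change ∑ᶠ χ ∈ IrrOf B, χ.1 g * (α χ).1 g⁻¹ = _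
  conv_lhs => rw [irrOf_eq_image]
  rw [finsum_mem_image Subtype.coe_injective.injOn, finsum_mem_eq_finite_toFinset_sum _ (Set.toFinite _)]
  exact Finset.sum_congr (by ext; simp) fun _ _ => rfl

open Classical in
theorem ncard_sep_eq_sum {E : Type*} {s : Set E} [Fintype s] {t : Set E} (ht : t ⊆ s)
    (P : E → Prop) : ({x ∈ t | P x}.ncard : AlgNum) =
      ∑ x : s with x.1 ∈ t, if P x.1 then 1 else 0 := by
  have h : {x ∈ t | P x} = Subtype.val '' {x : s | x.1 ∈ t ∧ P x.1} := by
    ext x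
    exact ⟨fun h => ⟨⟨x, ht h.1⟩, h, rfl⟩, by rintro ⟨x, h, rfl⟩; exact h⟩
  rw [h, Set.ncard_image_of_injective _ Subtype.coe_injective, Set.ncard_eq_toFinset_card',
    Finset.sum_boole]
  congr 2
  ext
  simp

variable {B α}

theorem inner_twistedSum (hIrr : ∀ χ ∈ IrrOf B, α χ ∈ IrrOf B) :
    (({χ ∈ IrrOf B | α χ = χ}.ncard : ℕ) : ℂ) = inner (trivialChar G) (twistedSum B α) := by
  classical
  have := Fintype.ofFinite (Irr G)
  refine (inner_trivialChar_eq_natCast ?_).symm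
  rw [ncard_sep_eq_sum (s := Irr G) fun χ h => h.1]
  simp only [twistedSum_apply]
  rw [Finset.sum_comm, Finset.mul_sum]
  refine Finset.sum_congr rfl fun χ hχ => ?_
  have h := pairing_irr χ ⟨α χ.1, (hIrr _ (Finset.mem_filter.1 hχ).2).1⟩
  rw [pairing_apply] at h
  rw [h]
  simp only [Subtype.ext_iff, eq_comm]

theorem inner_decompMap_twistedSum (hp : p.Prime) (hpI : (p : AlgInt) ∈ I)
    (hIBr : ∀ φ ∈ IBrOf B, α φ ∈ IBrOf B)
    (hα : ∀ f : ClassFun G, α (decompMap p f) = decompMap p (α f)) :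
    (({φ ∈ IBrOf B | α φ = φ}.ncard : ℕ) : ℂ) =
      inner (trivialChar G) (decompMap p (twistedSum B α)) := by
  classical
  have := Fintype.ofFinite (Irr G)
  have := finite_ibr (G := G) hp hpI
  have := Fintype.ofFinite (IBr G p I)
  refine (inner_trivialChar_eq_natCast ?_).symm
  rw [ncard_sep_eq_sum (s := IBr G p I) fun χ h => h.1]
  have h1 : ∀ g, (decompMap p (twistedSum B α)).1 g =
      ∑ χ : Irr G with χ.1 ∈ IrrOf B, (decompMap p χ.1).1 g * (α χ.1).1 g⁻¹ := fun g => by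
    by_cases hg : IsPRegular p g
    · refine ((if_pos hg).trans (twistedSum_apply B α g)).trans
        (Finset.sum_congr rfl fun χ _ => ?_)
      rw [show (decompMap p χ.1).1 g = χ.1.1 g from if_pos hg]
    · refine (if_neg hg).trans (Finset.sum_eq_zero fun χ _ => ?_).symm
      rw [show (decompMap p χ.1).1 g = 0 from if_neg hg, zero_mul]
  -- Move `d` across the pairing, commute it past `α`, and expand `dχ` in Brauer characters.
  have h2 : ∀ χ : Irr G, (Nat.card G : AlgNum)⁻¹ * ∑ g, (decompMap p χ.1).1 g * (α χ.1).1 g⁻¹ =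
      ∑ φ : IBr G p I, (decompNumber p I χ φ : AlgNum) * pairing χ.1 (α φ.1) := fun χ => by
    rw [← pairing_apply, pairing_decompMap_left, ← hα, decompMap_eq_sum_decompNumber hp hpI]
    simp only [map_sum, map_smul, smul_eq_mul]
  simp only [h1]
  rw [Finset.sum_comm, Finset.mul_sum, Finset.sum_congr rfl fun χ _ => h2 χ, Finset.sum_comm,
    Finset.sum_filter]
  refine Finset.sum_congr rfl fun φ _ => ?_
  by_cases hφ : φ.1 ∈ IBrOf B
  · have h3 := sum_decompNumber_mul_pairing hp hpI φ ⟨α φ.1, (hIBr _ hφ).1⟩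
    -- Characters outside `B` contribute zero, so the sum extends to all of `Irr G`, where duality
    -- applies.
    rw [Finset.sum_filter_of_ne fun χ _ hχ => mem_irrOf_of_decompNumber_ne_zero hφ fun h0 => by
      simp [h0] at hχ]
    rw [if_pos hφ]
    simpa only [Subtype.ext_iff] using h3
  · rw [if_neg hφ]
    refine Finset.sum_eq_zero fun χ hχ => ?_
    have : decompNumber p I χ φ = 0 := by
      by_contra h0
      exact hφ ⟨φ.2, χ, (Finset.mem_filter.1 hχ).2, h0⟩
    rw [this, Nat.cast_zero, zero_mul]

end Counting

end BrauerBlocks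

theorem mainTheorem12 {G : Type*} [Group G] [Fintype G] (p : ℕ) (hp : p.Prime)
    (I : Ideal BrauerBlocks.AlgInt) [I.IsMaximal] (hpI : (p : BrauerBlocks.AlgInt) ∈ I)
    (B : Set (BrauerBlocks.Block G p I))
    (α : BrauerBlocks.ClassFun G →ₗ[BrauerBlocks.AlgNum] BrauerBlocks.ClassFun G)
    (hIrr : ∀ χ ∈ BrauerBlocks.IrrOf B, α χ ∈ BrauerBlocks.IrrOf B)
    (hIBr : ∀ φ ∈ BrauerBlocks.IBrOf B, α φ ∈ BrauerBlocks.IBrOf B)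
    (hα : ∀ f : BrauerBlocks.ClassFun G,
      α (BrauerBlocks.decompMap p f) = BrauerBlocks.decompMap p (α f)) :
    (BrauerBlocks.IrrOf B).Finite ∧ (BrauerBlocks.IBrOf B).Finite ∧
    (({χ ∈ BrauerBlocks.IrrOf B | α χ = χ}.ncard : ℕ) : ℂ) =
      BrauerBlocks.inner (BrauerBlocks.trivialChar G) (BrauerBlocks.twistedSum B α) ∧
    (({φ ∈ BrauerBlocks.IBrOf B | α φ = φ}.ncard : ℕ) : ℂ) =
      BrauerBlocks.inner (BrauerBlocks.trivialChar G)
        (BrauerBlocks.decompMap p (BrauerBlocks.twistedSum B α)) :=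
  ⟨(Set.toFinite (BrauerBlocks.Irr G)).subset fun _ h => h.1,
    (Set.finite_coe_iff.1 (BrauerBlocks.finite_ibr hp hpI)).subset fun _ h => h.1,
    BrauerBlocks.inner_twistedSum hIrr,
    BrauerBlocks.inner_decompMap_twistedSum hp hpI hIBr hα⟩
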